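/- Let $a>0$, $b,c\in\mathbb{R}$ with $c\neq 0$, and $\theta_1,\theta_2\in[0,2\pi)$. On $\mathcal{H}=L^2(0,1)$ with $\langle f,g\rangle=\int_0^1 f g$, define for $f\in H^2(0,1)$ $$\mathcal{A}_c f = a f''+(b+c) f,\qquad \mathcal{B}f=\big(\cos(\theta_1)f(0)-\sin(\theta_1)f'(0),\ \cos(\theta_2)f(1)+\sin(\theta_2)f'(1)\big)\in\mathbb{R}^2,$$ and let $\mathcal{A}_{c,0}$ be the restriction of $\mathcal{A}_c$ to $H^2(0,1)\cap\ker\mathcal{B}$. Let $\lambda_1>\lambda_2>\cdots$ be the eigenvalues of $\mathcal{A}_{c,0}$, listed in strictly decreasing order, and for each $n\geq 1$ let $e_n$ be a unit eigenvector of $\mathcal{A}_{c,0}$ associated with $\lambda_n$. Let $k\geq 2$ be an integer with $\cos(\theta_m)+k\sin(\theta_m)\neq 0$ for $m\in\{1,2\}$, and for $u=(u_1,u_2)\in\mathbb{R}^2$ set $$[L_k u](x)=\frac{u_1(1-x)^k}{\cos(\theta_1)+k\sin(\theta_1)}+\frac{u_2x^k}{\cos(\theta_2)+k\sin(\theta_2)},\qquad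 x\in[0,1].$$ With $\{f_1,f_2\}$ the canonical basis of $\mathbb{R}^2$, put $$b_{n,m}=-\lambda_n\langle L_kf_m,e_n\rangle+\langle \mathcal{A}_cL_kf_m,e_n\rangle ,\qquad n\geq 1,\ m\in\{1,2\}.$$ For an integer $N_0\geq 1$ let $A=\mathrm{diag}(\lambda_1,\ldots,\lambda_{N_0})\in\mathbb{R}^{N_0\times N_0}$, let $B=(b_{n,m})_{1\le n\le N_0,\,1\le m\le 2}\in\mathbb{R}^{N_0\times 2}$, and let $B_1,B_2\in\mathbb{R}^{N_0}$ be the columns of $B$. Then, for every $N_0\geq 1$, each of the pairs $(A,B)$, $(A,B_1)$ and $(A,B_2)$ satisfies the Kalman condition, that is, the matrices $[B, AB,\ldots,A^{N_0-1}B]$, $[B_1, AB_1,\ldots,A^{N_0-1}B_1]$ and $[B_2, AB_2,\ldots,A^{N_0-1}B_2]$ all have rank $N_0$. -/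

import Mathlib

open MeasureTheory Set

noncomputable section

namespace RobinHeat

/-- First derivative on `[0,1]` (one-sided at the two end points). -/
def D (f : ℝ → ℝ) : ℝ → ℝ := derivWithin f (Icc 0 1)

/-- Membership in `H²(0,1)`: `f` is `C¹` on `[0,1]`, its derivative is absolutely continuous on
`[0,1]`, and the (almost everywhere defined) second derivative is in `L²(0,1)`.
A class of `L²(0,1)` that lies in `H²(0,1)` is represented by its unique `C¹` representative. -/
def MemH2 (f : ℝ → ℝ) : Prop :=
  ContDiffOn ℝ 1 f (Icc 0 1) ∧
    AbsolutelyContinuousOnInterval (D f) 0 1 ∧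
    MemLp (D (D f)) 2 (volume.restrict (Ioo 0 1))

/-- The inner product of `L²(0,1)`. -/
def ip (f g : ℝ → ℝ) : ℝ := ∫ x in Ioo (0 : ℝ) 1, f x * g x

/-- The operator `𝒜 f = a f'' + b f`, with domain `H²(0,1)`. -/
def opA (a b : ℝ) (f : ℝ → ℝ) : ℝ → ℝ := fun x => a * D (D f) x + b * f x

/-- The operator `𝒜_c = 𝒜 + c I`, with domain `H²(0,1)`. -/
def opAc (a b c : ℝ) (f : ℝ → ℝ) : ℝ → ℝ := fun x => opA a b f x + c * f x

/-- The boundary operator `ℬ`, with domain `H²(0,1)`; `θ 0`, `θ 1` stand for `θ₁`, `θ₂`. -/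
def opB (θ : Fin 2 → ℝ) (f : ℝ → ℝ) : Fin 2 → ℝ :=
  ![Real.cos (θ 0) * f 0 - Real.sin (θ 0) * D f 0,
    Real.cos (θ 1) * f 1 + Real.sin (θ 1) * D f 1]

/-- Membership in the domain `H²(0,1) ∩ ker ℬ` of `𝒜_{c,0}`. -/
def MemDom0 (θ : Fin 2 → ℝ) (f : ℝ → ℝ) : Prop := MemH2 f ∧ opB θ f = 0

/-- `e` is a unit eigenvector of `𝒜_{c,0}` (the restriction of `𝒜_c` to `H²(0,1) ∩ ker ℬ`)
for the eigenvalue `μ`; the eigenvalue equation is an equation in `L²(0,1)`. -/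
def IsUnitEigenvector (a b c : ℝ) (θ : Fin 2 → ℝ) (μ : ℝ) (e : ℝ → ℝ) : Prop :=
  MemDom0 θ e ∧ ip e e = 1 ∧
    ∀ᵐ x ∂(volume.restrict (Ioo (0 : ℝ) 1)), opAc a b c e x = μ * e x

/-- The set of eigenvalues of `𝒜_{c,0}`. -/
def eigenvalues (a b c : ℝ) (θ : Fin 2 → ℝ) : Set ℝ :=
  {μ | ∃ e, IsUnitEigenvector a b c θ μ e}

/-- The lifting operator `L_k`. -/
def lift (θ : Fin 2 → ℝ) (k : ℕ) (u : Fin 2 → ℝ) : ℝ → ℝ := fun x =>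
  u 0 * (1 - x) ^ k / (Real.cos (θ 0) + k * Real.sin (θ 0)) +
    u 1 * x ^ k / (Real.cos (θ 1) + k * Real.sin (θ 1))

/-- `-μ ⟨L_k f_m, e⟩ + ⟨𝒜_c L_k f_m, e⟩`, where `f_m` is the `m`-th canonical basis vector. -/
def inputCoeff (a b c : ℝ) (θ : Fin 2 → ℝ) (k : ℕ) (μ : ℝ) (e : ℝ → ℝ) (m : Fin 2) : ℝ :=
  -μ * ip (lift θ k (Pi.single m 1)) e + ip (opAc a b c (lift θ k (Pi.single m 1))) e

/-- `A = diag(λ₁, …, λ_N)`; the sequence is indexed from `0`. -/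
def matA (N : ℕ) (lam : ℕ → ℝ) : Matrix (Fin N) (Fin N) ℝ :=
  Matrix.diagonal fun n => lam n

/-- `B = (b_{n,m})`, of size `N × 2`. -/
def matB (a b c : ℝ) (θ : Fin 2 → ℝ) (k N : ℕ) (lam : ℕ → ℝ) (e : ℕ → ℝ → ℝ) :
    Matrix (Fin N) (Fin 2) ℝ :=
  Matrix.of fun n m => inputCoeff a b c θ k (lam n) (e n) m

/-- The `m`-th column of `B`, as a matrix with one column. -/
def column {N : ℕ} (B : Matrix (Fin N) (Fin 2) ℝ) (m : Fin 2) : Matrix (Fin N) (Fin 1) ℝ :=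
  Matrix.of fun n _ => B n m

/-- The controllability matrix `[B, AB, …, A^{N-1}B]`; column `(j, m)` is the `m`-th column of
`A^j B`. -/
def kalmanMatrix {N p : ℕ} (A : Matrix (Fin N) (Fin N) ℝ) (B : Matrix (Fin N) (Fin p) ℝ) :
    Matrix (Fin N) (Fin N × Fin p) ℝ :=
  Matrix.of fun i jm => (A ^ (jm.1 : ℕ) * B) i jm.2

/-- The Kalman rank condition for the pair `(A, B)`. -/
def Kalman {N p : ℕ} (A : Matrix (Fin N) (Fin N) ℝ) (B : Matrix (Fin N) (Fin p) ℝ) : Prop :=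
  (kalmanMatrix A B).rank = N

end RobinHeat

end

/-!
Since `A` is diagonal with distinct entries, a column `B_m` without zero entry turns
`[B_m, A B_m, …]` into an invertible diagonal matrix times a Vandermonde matrix, so it suffices that
`b_{n,m} ≠ 0`. The operator `ℬ` measures one direction of the Cauchy data `(f, f')` at each end
point; if `ℬ'` measures the orthogonal direction, Green's formula on `H²(0,1)` reads
`⟨𝒜_c f, g⟩ - ⟨f, 𝒜_c g⟩ = a (ℬf ⬝ ℬ'g - ℬ'f ⬝ ℬg)`. As `L_k` is a right inverse of `ℬ` and
`ℬ e_n = 0`, it gives `b_{n,m} = a (ℬ' e_n)_m`. Were this zero, the Cauchy data of `e_n` would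
vanish at an end point, and `e_n`, a solution of a second-order linear ODE, would vanish
identically.
-/

namespace RobinHeat

theorem kalman_diagonal_of_column_ne_zero {N p : ℕ} {d : Fin N → ℝ} (hd : Function.Injective d)
    {B : Matrix (Fin N) (Fin p) ℝ} (m : Fin p) (hB : ∀ n, B n m ≠ 0) :
    Kalman (Matrix.diagonal d) B := by
  have hsub : (kalmanMatrix (Matrix.diagonal d) B).submatrix id (fun j => (j, m)) =
      Matrix.diagonal (fun n => B n m) * Matrix.vandermonde d := by
    ext i j
    simp [kalmanMatrix, Matrix.diagonal_pow, Matrix.diagonal_mul, Matrix.vandermonde_apply,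
      mul_comm]
  have hunit : IsUnit (Matrix.diagonal (fun n => B n m) * Matrix.vandermonde d) := by
    rw [Matrix.isUnit_iff_isUnit_det, Matrix.det_mul, Matrix.det_diagonal, isUnit_iff_ne_zero]
    exact mul_ne_zero (Finset.prod_ne_zero_iff.2 fun n _ => hB n)
      (Matrix.det_vandermonde_ne_zero_iff.2 hd)
  refine le_antisymm (by simpa using Matrix.rank_le_card_height (kalmanMatrix _ B)) ?_
  calc N = ((kalmanMatrix (Matrix.diagonal d) B).submatrix id (fun j => (j, m))).rank := by
        rw [hsub, Matrix.rank_of_isUnit _ hunit, Fintype.card_fin]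
    _ ≤ (kalmanMatrix (Matrix.diagonal d) B).rank := Matrix.rank_submatrix_le _ _ _

section LinearODE

variable {E : Type*} [NormedAddCommGroup E] [NormedSpace ℝ E] {u v t₀ : ℝ}

theorem eqOn_zero_of_hasDerivWithinAt_clm_apply {A : ℝ → E →L[ℝ] E} {K : NNReal} {y : ℝ → E}
    (hA : ∀ t ∈ Icc u v, ‖A t‖₊ ≤ K)
    (hy : ∀ t ∈ Icc u v, HasDerivWithinAt y (A t (y t)) (Icc u v) t)
    (ht₀ : t₀ ∈ Icc u v) (hy₀ : y t₀ = 0) : EqOn y 0 (Icc u v) := by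
  have hlip : ∀ t ∈ Icc u v, LipschitzOnWith K (A t) univ := fun t ht =>
    ((A t).lipschitz.weaken (hA t ht)).lipschitzOnWith
  have hcont : ContinuousOn y (Icc u v) := fun t ht => (hy t ht).continuousWithinAt
  have hzero : ∀ (s : Set ℝ) (t : ℝ), HasDerivWithinAt (0 : ℝ → E) (A t 0) s t := fun s t =>
    (hasDerivWithinAt_const t s (0 : E)).congr_deriv (map_zero (A t)).symm
  rw [← Icc_union_Icc_eq_Icc ht₀.1 ht₀.2]
  refine EqOn.union ?left ?right
  case left =>
    have hsub : Icc u t₀ ⊆ Icc u v := Icc_subset_Icc_right ht₀.2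
    exact ODE_solution_unique_of_mem_Icc_left
      (fun t ht => hlip t (hsub (Ioc_subset_Icc_self ht))) (hcont.mono hsub)
      (fun t ht => ((hy t (hsub (Ioc_subset_Icc_self ht))).mono hsub).mono_of_mem_nhdsWithin
        (Icc_mem_nhdsLE_of_mem ht))
      (fun _ _ => mem_univ _) continuousOn_const (fun t _ => hzero _ t) (fun _ _ => mem_univ _) hy₀
  case right =>
    have hsub : Icc t₀ v ⊆ Icc u v := Icc_subset_Icc_left ht₀.1
    exact ODE_solution_unique_of_mem_Icc_right
      (fun t ht => hlip t (hsub (Ico_subset_Icc_self ht))) (hcont.mono hsub)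
      (fun t ht => ((hy t (hsub (Ico_subset_Icc_self ht))).mono hsub).mono_of_mem_nhdsWithin
        (Icc_mem_nhdsGE_of_mem ht))
      (fun _ _ => mem_univ _) continuousOn_const (fun t _ => hzero _ t) (fun _ _ => mem_univ _) hy₀

theorem eqOn_zero_of_hasDerivWithinAt_of_hasDerivWithinAt_smul {q : ℝ → ℝ} {y y' : ℝ → E}
    (hq : ContinuousOn q (Icc u v))
    (hy : ∀ t ∈ Icc u v, HasDerivWithinAt y (y' t) (Icc u v) t)
    (hy' : ∀ t ∈ Icc u v, HasDerivWithinAt y' (q t • y t) (Icc u v) t)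
    (ht₀ : t₀ ∈ Icc u v) (hy₀ : y t₀ = 0) (hy'₀ : y' t₀ = 0) : EqOn y 0 (Icc u v) := by
  obtain ⟨M, hM⟩ := isCompact_Icc.exists_bound_of_continuousOn hq
  let A : ℝ → E × E →L[ℝ] E × E := fun t =>
    (ContinuousLinearMap.snd ℝ E E).prod (q t • ContinuousLinearMap.fst ℝ E E)
  have hA : ∀ t ∈ Icc u v, ‖A t‖₊ ≤ (max 1 M).toNNReal := fun t ht => by
    refine NNReal.le_toNNReal_of_coe_le ?_
    rw [coe_nnnorm, ContinuousLinearMap.opNorm_prod]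
    refine max_le_max (ContinuousLinearMap.norm_snd_le ℝ E E) ?_
    calc ‖q t • ContinuousLinearMap.fst ℝ E E‖ ≤ ‖q t‖ * 1 := by
          rw [norm_smul]; gcongr; exact ContinuousLinearMap.norm_fst_le ℝ E E
      _ ≤ M := by rw [mul_one]; exact hM t ht
  have hzero := eqOn_zero_of_hasDerivWithinAt_clm_apply (A := A) (y := fun t => (y t, y' t)) hA
    (fun t ht => (hy t ht).prodMk (hy' t ht)) ht₀ (Prod.ext hy₀ hy'₀)
  exact fun t ht => congrArg Prod.fst (hzero ht)

end LinearODE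

theorem hasDerivWithinAt_of_deriv_ae_eq {F g : ℝ → ℝ} {u v x : ℝ}
    (hF : AbsolutelyContinuousOnInterval F u v) (hg : ContinuousOn g (uIcc u v))
    (hFg : ∀ᵐ t, t ∈ uIoc u v → deriv F t = g t) (hx : x ∈ uIcc u v) :
    HasDerivWithinAt F (g x) (uIcc u v) x := by
  have hsub : ∀ {y}, y ∈ uIcc u v → uIcc u y ⊆ uIcc u v := fun hy => uIcc_subset_uIcc_left hy
  have hprim : ∀ y ∈ uIcc u v, F y = (∫ t in u..y, g t) + F u := fun y hy => by
    have hcongr : ∫ t in u..y, deriv F t = ∫ t in u..y, g t :=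
      intervalIntegral.integral_congr_ae (hFg.mono fun t ht hty =>
        ht (uIoc_subset_uIoc_of_uIcc_subset_uIcc (hsub hy) hty))
    rw [← hcongr, (hF.mono (hsub hy)).integral_deriv_eq_sub, sub_add_cancel]
  have : Fact (x ∈ uIcc u v) := ⟨hx⟩
  have hderiv : HasDerivWithinAt (fun y => ∫ t in u..y, g t) (g x) (uIcc u v) x :=
    intervalIntegral.integral_hasDerivWithinAt_right (hg.mono (hsub hx)).intervalIntegrable
      (hg.stronglyMeasurableAtFilter_nhdsWithin measurableSet_uIcc x) (hg x hx)
  exact (hderiv.add_const (F u)).congr hprim (hprim x hx)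

theorem D_eq_deriv_of_mem_Ioo {f : ℝ → ℝ} {x : ℝ} (hx : x ∈ Ioo (0 : ℝ) 1) : D f x = deriv f x :=
  derivWithin_of_mem_nhds (Icc_mem_nhds hx.1 hx.2)

theorem ip_comm (f g : ℝ → ℝ) : ip f g = ip g f := by
  simp only [ip, mul_comm]

theorem ip_D_eq_intervalIntegral (f g : ℝ → ℝ) :
    ip f (D g) = ∫ x in (0 : ℝ)..1, f x * deriv g x := by
  rw [intervalIntegral.integral_of_le zero_le_one, integral_Ioc_eq_integral_Ioo]
  exact setIntegral_congr_fun measurableSet_Ioo fun x hx => by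
    simp only [D_eq_deriv_of_mem_Ioo hx]

theorem ip_D_right {f g : ℝ → ℝ} (hf : AbsolutelyContinuousOnInterval f 0 1)
    (hg : AbsolutelyContinuousOnInterval g 0 1) :
    ip f (D g) = f 1 * g 1 - f 0 * g 0 - ip (D f) g := by
  rw [ip_comm (D f), ip_D_eq_intervalIntegral, ip_D_eq_intervalIntegral,
    hf.integral_mul_deriv_eq_deriv_mul hg]
  simp only [mul_comm]

section Sobolev

variable {f g : ℝ → ℝ}

theorem memH2_of_contDiffOn (hf : ContDiffOn ℝ 2 f (Icc 0 1)) : MemH2 f := by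
  have hunique : UniqueDiffOn ℝ (Icc (0 : ℝ) 1) := uniqueDiffOn_Icc zero_lt_one
  have hD : ContDiffOn ℝ 1 (D f) (Icc 0 1) := hf.derivWithin hunique one_add_one_eq_two.le
  have hDD : ContinuousOn (D (D f)) (Icc 0 1) := hD.continuousOn_derivWithin hunique le_rfl
  obtain ⟨M, hM⟩ := isCompact_Icc.exists_bound_of_continuousOn hDD
  refine ⟨hf.of_le one_le_two, ?_, MemLp.of_bound ?_ M ?_⟩
  · exact ContDiffOn.absolutelyContinuousOnInterval (by rwa [uIcc_of_le zero_le_one])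
  · exact (hDD.mono Ioo_subset_Icc_self).aestronglyMeasurable measurableSet_Ioo
  · exact ae_restrict_of_forall_mem measurableSet_Ioo fun x hx => hM x (Ioo_subset_Icc_self hx)

theorem MemH2.absolutelyContinuousOnInterval (hf : MemH2 f) :
    AbsolutelyContinuousOnInterval f 0 1 :=
  ContDiffOn.absolutelyContinuousOnInterval (by rw [uIcc_of_le zero_le_one]; exact hf.1)

theorem MemH2.hasDerivWithinAt (hf : MemH2 f) {x : ℝ} (hx : x ∈ Icc (0 : ℝ) 1) :
    HasDerivWithinAt f (D f x) (Icc 0 1) x :=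
  (hf.1.differentiableOn one_ne_zero x hx).hasDerivWithinAt

theorem MemH2.hasDerivWithinAt_D (hf : MemH2 f) (hg : ContinuousOn g (Icc 0 1))
    (hfg : D (D f) =ᵐ[volume.restrict (Ioo 0 1)] g) {x : ℝ} (hx : x ∈ Icc (0 : ℝ) 1) :
    HasDerivWithinAt (D f) (g x) (Icc 0 1) x := by
  have hderiv : ∀ᵐ t, t ∈ uIoc (0 : ℝ) 1 → deriv (D f) t = g t := by
    rw [uIoc_of_le zero_le_one, ← ae_restrict_iff' measurableSet_Ioc,
      ← restrict_Ioo_eq_restrict_Ioc]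
    filter_upwards [hfg, ae_restrict_mem measurableSet_Ioo] with t ht htm
    rw [← ht, D_eq_deriv_of_mem_Ioo htm]
  rw [← uIcc_of_le (zero_le_one' ℝ)] at hg hx ⊢
  exact hasDerivWithinAt_of_deriv_ae_eq hf.2.1 hg hderiv hx

theorem MemH2.ip_D_D_sub_ip_D_D (hf : MemH2 f) (hg : MemH2 g) :
    ip (D (D f)) g - ip f (D (D g)) =
      (D f 1 * g 1 - f 1 * D g 1) - (D f 0 * g 0 - f 0 * D g 0) := by
  rw [ip_comm (D (D f)) g, ip_D_right hg.absolutelyContinuousOnInterval hf.2.1,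
    ip_D_right hf.absolutelyContinuousOnInterval hg.2.1, ip_comm (D g) (D f)]
  ring

theorem MemH2.ip_opAc_left (a b c : ℝ) (hf : MemH2 f) (hg : ContinuousOn g (Icc 0 1)) :
    ip (opAc a b c f) g = a * ip (D (D f)) g + (b + c) * ip f g := by
  have hfg : IntegrableOn (fun x => f x * g x) (Ioo 0 1) :=
    ((hf.1.continuousOn.mul hg).integrableOn_Icc).mono_set Ioo_subset_Icc_self
  have hDDfg : IntegrableOn (fun x => D (D f) x * g x) (Ioo 0 1) :=
    IntegrableOn.mul_continuousOn_of_subset (hf.2.2.integrable one_le_two) hg measurableSet_Ioo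
      isCompact_Icc Ioo_subset_Icc_self
  simp only [ip, ← integral_const_mul]
  rw [← integral_add (hDDfg.const_mul a) (hfg.const_mul (b + c))]
  simp only [opAc, opA]
  congr 1 with x
  ring

end Sobolev

/-- The boundary operator complementary to `opB`: at each end point the functionals of `opB` and
`opBCompl` form, up to sign, an orthonormal basis of the dual of the plane of Cauchy data. The signs
make Green's formula pair the two operators, so that `b_{n,m}` is `a` times the `m`-th component of
`opBCompl θ e_n`. -/
noncomputable def opBCompl (θ : Fin 2 → ℝ) (f : ℝ → ℝ) : Fin 2 → ℝ :=
  ![Real.sin (θ 0) * f 0 + Real.cos (θ 0) * D f 0,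
    Real.sin (θ 1) * f 1 - Real.cos (θ 1) * D f 1]

theorem opB_dotProduct_opBCompl_sub (θ : Fin 2 → ℝ) (f g : ℝ → ℝ) :
    opB θ f ⬝ᵥ opBCompl θ g - opBCompl θ f ⬝ᵥ opB θ g =
      (D f 1 * g 1 - f 1 * D g 1) - (D f 0 * g 0 - f 0 * D g 0) := by
  simp only [opB, opBCompl, Matrix.vec2_dotProduct, Matrix.cons_val_zero, Matrix.cons_val_one]
  linear_combination (f 0 * D g 0 - D f 0 * g 0) * Real.sin_sq_add_cos_sq (θ 0) +
    (D f 1 * g 1 - f 1 * D g 1) * Real.sin_sq_add_cos_sq (θ 1)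

theorem MemH2.green {f g : ℝ → ℝ} (a b c : ℝ) (θ : Fin 2 → ℝ) (hf : MemH2 f) (hg : MemH2 g) :
    ip (opAc a b c f) g - ip f (opAc a b c g) =
      a * (opB θ f ⬝ᵥ opBCompl θ g - opBCompl θ f ⬝ᵥ opB θ g) := by
  rw [ip_comm f (opAc a b c g), hf.ip_opAc_left a b c hg.1.continuousOn,
    hg.ip_opAc_left a b c hf.1.continuousOn, opB_dotProduct_opBCompl_sub,
    ← hf.ip_D_D_sub_ip_D_D hg, ip_comm g f, ip_comm (D (D g)) f]
  ring

theorem eq_zero_of_rotation_eq_zero {t x y : ℝ} (hcos : Real.cos t * x - Real.sin t * y = 0)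
    (hsin : Real.sin t * x + Real.cos t * y = 0) : x = 0 ∧ y = 0 := by
  constructor
  · linear_combination Real.cos t * hcos + Real.sin t * hsin - x * Real.sin_sq_add_cos_sq t
  · linear_combination Real.cos t * hsin - Real.sin t * hcos - y * Real.sin_sq_add_cos_sq t

section Eigenvector

variable {a b c μ : ℝ} {θ : Fin 2 → ℝ} {e f : ℝ → ℝ}

theorem IsUnitEigenvector.not_eqOn_zero (he : IsUnitEigenvector a b c θ μ e) :
    ¬ EqOn e 0 (Icc 0 1) := fun hzero => by
  have hnorm : ip e e = 0 := setIntegral_eq_zero_of_forall_eq_zero fun x hx => by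
    simp [hzero (Ioo_subset_Icc_self hx)]
  exact one_ne_zero (he.2.1.symm.trans hnorm)

theorem IsUnitEigenvector.ip_opAc_right (he : IsUnitEigenvector a b c θ μ e) (f : ℝ → ℝ) :
    ip f (opAc a b c e) = μ * ip f e := by
  rw [ip, ip, ← integral_const_mul]
  refine integral_congr_ae ?_
  filter_upwards [he.2.2] with x hx
  rw [hx, mul_left_comm]

theorem IsUnitEigenvector.hasDerivWithinAt_D (ha : a ≠ 0) (he : IsUnitEigenvector a b c θ μ e)
    {x : ℝ} (hx : x ∈ Icc (0 : ℝ) 1) :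
    HasDerivWithinAt (D e) ((μ - b - c) / a * e x) (Icc 0 1) x := by
  refine he.1.1.hasDerivWithinAt_D (he.1.1.1.continuousOn.const_mul ((μ - b - c) / a)) ?_ hx
  filter_upwards [he.2.2] with y hy
  simp only [opAc, opA] at hy
  field_simp
  linear_combination hy

theorem IsUnitEigenvector.cauchyData_ne_zero (ha : a ≠ 0) (he : IsUnitEigenvector a b c θ μ e)
    {x : ℝ} (hx : x ∈ Icc (0 : ℝ) 1) : ¬ (e x = 0 ∧ D e x = 0) := fun ⟨h, h'⟩ =>
  he.not_eqOn_zero <| eqOn_zero_of_hasDerivWithinAt_of_hasDerivWithinAt_smul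
    continuousOn_const (fun _ ht => he.1.1.hasDerivWithinAt ht)
    (fun _ ht => he.hasDerivWithinAt_D ha ht) hx h h'

theorem IsUnitEigenvector.opBCompl_ne_zero (ha : a ≠ 0) (he : IsUnitEigenvector a b c θ μ e)
    (m : Fin 2) : opBCompl θ e m ≠ 0 := by
  intro hco
  have hB := congrFun he.1.2 m
  fin_cases m
  · exact he.cauchyData_ne_zero ha (left_mem_Icc.2 zero_le_one) (eq_zero_of_rotation_eq_zero hB hco)
  · have hrot := eq_zero_of_rotation_eq_zero (t := θ 1) (x := e 1) (y := -D e 1)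
      (by simpa [opB] using hB) (by simpa [opBCompl, sub_eq_add_neg] using hco)
    exact he.cauchyData_ne_zero ha (right_mem_Icc.2 zero_le_one) ⟨hrot.1, neg_eq_zero.1 hrot.2⟩

theorem IsUnitEigenvector.neg_mul_ip_add_ip_opAc (he : IsUnitEigenvector a b c θ μ e)
    (hf : MemH2 f) :
    -μ * ip f e + ip (opAc a b c f) e = a * (opB θ f ⬝ᵥ opBCompl θ e) := by
  have hgreen := hf.green a b c θ he.1.1
  rw [he.ip_opAc_right f, he.1.2, dotProduct_zero, sub_zero] at hgreen
  linear_combination hgreen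

end Eigenvector

section Lift

variable {θ : Fin 2 → ℝ} {k : ℕ}

theorem memH2_lift (θ : Fin 2 → ℝ) (k : ℕ) (u : Fin 2 → ℝ) : MemH2 (lift θ k u) :=
  memH2_of_contDiffOn (ContDiff.contDiffOn (by unfold lift; fun_prop))

theorem D_lift (θ : Fin 2 → ℝ) (k : ℕ) (u : Fin 2 → ℝ) {x : ℝ} (hx : x ∈ Icc (0 : ℝ) 1) :
    D (lift θ k u) x =
      -(u 0 * (k * (1 - x) ^ (k - 1))) / (Real.cos (θ 0) + k * Real.sin (θ 0)) +
        u 1 * (k * x ^ (k - 1)) / (Real.cos (θ 1) + k * Real.sin (θ 1)) := by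
  have hleft := ((((hasDerivAt_id x).const_sub 1).fun_pow k).const_mul (u 0)).div_const
    (Real.cos (θ 0) + k * Real.sin (θ 0))
  have hright := ((hasDerivAt_pow k x).const_mul (u 1)).div_const
    (Real.cos (θ 1) + k * Real.sin (θ 1))
  have hderiv := (hleft.add hright).hasDerivWithinAt.derivWithin
    (uniqueDiffOn_Icc zero_lt_one x hx)
  exact hderiv.trans (by simp only [id]; ring)

theorem opB_lift (hk : 2 ≤ k) (hkθ : ∀ m, Real.cos (θ m) + k * Real.sin (θ m) ≠ 0)
    (u : Fin 2 → ℝ) : opB θ (lift θ k u) = u := by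
  have hpow : (0 : ℝ) ^ k = 0 := zero_pow (by lia)
  have hpow' : (0 : ℝ) ^ (k - 1) = 0 := zero_pow (by lia)
  have hD₀ := D_lift θ k u (left_mem_Icc.2 zero_le_one)
  have hD₁ := D_lift θ k u (right_mem_Icc.2 zero_le_one)
  have h₀ := hkθ 0
  have h₁ := hkθ 1
  ext m
  fin_cases m
  · change Real.cos (θ 0) * lift θ k u 0 - Real.sin (θ 0) * D (lift θ k u) 0 = u 0
    simp only [hD₀, lift, sub_zero, one_pow, hpow, hpow']
    field_simp
    ring
  · change Real.cos (θ 1) * lift θ k u 1 + Real.sin (θ 1) * D (lift θ k u) 1 = u 1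
    simp only [hD₁, lift, sub_self, one_pow, hpow, hpow']
    field_simp
    ring

theorem IsUnitEigenvector.inputCoeff_eq {a b c μ : ℝ} {e : ℝ → ℝ}
    (he : IsUnitEigenvector a b c θ μ e) (hk : 2 ≤ k)
    (hkθ : ∀ m, Real.cos (θ m) + k * Real.sin (θ m) ≠ 0) (m : Fin 2) :
    inputCoeff a b c θ k μ e m = a * opBCompl θ e m := by
  rw [inputCoeff, he.neg_mul_ip_add_ip_opAc (memH2_lift θ k _), opB_lift hk hkθ,
    single_one_dotProduct]

end Lift

end RobinHeat

theorem lemma1_general {a b c : ℝ} (ha : a ≠ 0) {θ : Fin 2 → ℝ} {k : ℕ} (hk : 2 ≤ k)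
    (hkθ : ∀ m, Real.cos (θ m) + k * Real.sin (θ m) ≠ 0) {N : ℕ} {lam : ℕ → ℝ}
    (hlam : InjOn lam (Iio N)) {e : ℕ → ℝ → ℝ}
    (he : ∀ n < N, RobinHeat.IsUnitEigenvector a b c θ (lam n) (e n)) :
    RobinHeat.Kalman (RobinHeat.matA N lam) (RobinHeat.matB a b c θ k N lam e) ∧
    RobinHeat.Kalman (RobinHeat.matA N lam)
      (RobinHeat.column (RobinHeat.matB a b c θ k N lam e) 0) ∧
    RobinHeat.Kalman (RobinHeat.matA N lam)
      (RobinHeat.column (RobinHeat.matB a b c θ k N lam e) 1) := by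
  have hdistinct : Function.Injective fun n : Fin N => lam n := fun i j hij =>
    Fin.ext (hlam i.2 j.2 hij)
  have hB : ∀ m (n : Fin N), RobinHeat.matB a b c θ k N lam e n m ≠ 0 := fun m n => by
    rw [RobinHeat.matB, Matrix.of_apply, (he n n.2).inputCoeff_eq hk hkθ]
    exact mul_ne_zero ha ((he n n.2).opBCompl_ne_zero ha m)
  exact ⟨RobinHeat.kalman_diagonal_of_column_ne_zero hdistinct 0 (hB 0),
    RobinHeat.kalman_diagonal_of_column_ne_zero hdistinct 0 (hB 0),
    RobinHeat.kalman_diagonal_of_column_ne_zero hdistinct 0 (hB 1)⟩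

theorem lemma1 (a b c : ℝ) (ha : 0 < a) (hc : c ≠ 0)
    (θ : Fin 2 → ℝ) (hθ : ∀ m, θ m ∈ Set.Ico 0 (2 * Real.pi))
    (k : ℕ) (hk : 2 ≤ k) (hkθ : ∀ m, Real.cos (θ m) + k * Real.sin (θ m) ≠ 0)
    (lam : ℕ → ℝ) (hlam : StrictAnti lam)
    (hspec : Set.range lam = RobinHeat.eigenvalues a b c θ)
    (e : ℕ → ℝ → ℝ) (he : ∀ n, RobinHeat.IsUnitEigenvector a b c θ (lam n) (e n))
    (N₀ : ℕ) (hN₀ : 1 ≤ N₀) :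
    RobinHeat.Kalman (RobinHeat.matA N₀ lam) (RobinHeat.matB a b c θ k N₀ lam e) ∧
    RobinHeat.Kalman (RobinHeat.matA N₀ lam)
      (RobinHeat.column (RobinHeat.matB a b c θ k N₀ lam e) 0) ∧
    RobinHeat.Kalman (RobinHeat.matA N₀ lam)
      (RobinHeat.column (RobinHeat.matB a b c θ k N₀ lam e) 1) :=
  lemma1_general ha.ne' hk hkθ hlam.injective.injOn fun n _ => he n
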